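/- A $d$-polytope is the convex hull of a finite nonempty set of points in some $\mathbb{R}^n$ whose affine hull has dimension $d$. Its graph has the vertices of the polytope as nodes, two of them being adjacent when the segment joining them is a face (an edge) of the polytope. Two polytopes are combinatorially equivalent if their face lattices are isomorphic, and a $d$-polytope is inscribable if it is combinatorially equivalent to a $d$-polytope in $\mathbb{R}^d$ all of whose vertices lie on the unit sphere of $\mathbb{R}^d$. **Theorem (Grünbaum–Jucovič).** Let $P$ be a $d$-polytope with graph $G$. Suppose that $G$ has an independent set (a set of vertices no two of which are adjacent) that contains more than half of all the vertices of $P$, or that $G$ is not bipartite and has an independent set that contains exactly half of all the vertices of $P$. Then $P$ is not inscribable. -/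

import Mathlib

/-- A (convex) polytope: the convex hull of a finite nonempty set of points. -/
def IsPolytope {n : ℕ} (P : Set (EuclideanSpace ℝ (Fin n))) : Prop :=
  ∃ S : Set (EuclideanSpace ℝ (Fin n)), S.Finite ∧ S.Nonempty ∧ P = convexHull ℝ S

/-- A `d`-polytope: a polytope (in some `ℝⁿ`) whose affine hull has dimension `d`. -/
def IsDPolytope {n : ℕ} (d : ℕ) (P : Set (EuclideanSpace ℝ (Fin n))) : Prop :=
  IsPolytope P ∧ Module.finrank ℝ (affineSpan ℝ P).direction = d

/-- The vertices of a polytope are its extreme points. -/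
abbrev PolytopeVertex {n : ℕ} (P : Set (EuclideanSpace ℝ (Fin n))) : Type :=
  {v : EuclideanSpace ℝ (Fin n) // v ∈ P.extremePoints ℝ}

/-- The graph of a polytope: two distinct vertices are adjacent when the segment joining them
is a face (an edge) of the polytope. -/
def polytopeGraph {n : ℕ} (P : Set (EuclideanSpace ℝ (Fin n))) :
    SimpleGraph (PolytopeVertex P) where
  Adj v w := v ≠ w ∧ IsExposed ℝ P (segment ℝ v.1 w.1)
  symm := ⟨fun v w h => ⟨h.1.symm, by rw [segment_symm]; exact h.2⟩⟩
  loopless := ⟨fun _ h => h.1 rfl⟩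

/-- The face lattice of a polytope, ordered by inclusion. The faces are the empty set and the
sets of maximizers on `P` of a linear functional (the zero functional gives `P` itself); these
are exactly the sets `F` with `IsExposed ℝ P F`. -/
abbrev FaceLattice {n : ℕ} (P : Set (EuclideanSpace ℝ (Fin n))) : Type :=
  {F : Set (EuclideanSpace ℝ (Fin n)) // IsExposed ℝ P F}

/-- Two polytopes are combinatorially equivalent when their face lattices are isomorphic. -/
def CombinatoriallyEquivalent {m n : ℕ} (P : Set (EuclideanSpace ℝ (Fin m)))
    (Q : Set (EuclideanSpace ℝ (Fin n))) : Prop :=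
  Nonempty (FaceLattice P ≃o FaceLattice Q)

/-- A `d`-polytope `P` is inscribable when some `d`-polytope in `ℝᵈ` that is combinatorially
equivalent to `P` has all its vertices on the unit sphere of `ℝᵈ`. -/
def IsInscribable {n : ℕ} (d : ℕ) (P : Set (EuclideanSpace ℝ (Fin n))) : Prop :=
  ∃ Q : Set (EuclideanSpace ℝ (Fin d)), IsDPolytope d Q ∧ CombinatoriallyEquivalent P Q ∧
    Q.extremePoints ℝ ⊆ Metric.sphere 0 1

/-!
The graph of an inscribed polytope `Q` carries positive edge weights that have the same sum at every
vertex (`IsDPolytope.isBalancedWeighting`). Given such weights, the edges at an independent set `I`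
all end in the complement of `I`, so comparing total weights gives `2 * card I ≤ card V`; in case of
equality no weight is left for edges inside the complement, which is then independent as well, and
the graph is bipartite (`IsBalancedWeighting.two_mul_card_le`, `IsBalancedWeighting.isBipartite`).

The weights are solid angles. Inversion in a sphere centred at the vertex `v i` maps the other
vertices into a hyperplane, where their images span the vertex figure at `v i`. The normal cones of
the vertex figure at its vertices (`inversionCell`) cover the space and overlap in null sets, so
their parts in the unit ball have volumes `cellWeight v i j` that add up to the volume of the ball
(`sum_cellWeight`). A cell has positive volume exactly when its point is a vertex of the vertex
figure, that is, when `v i` and `v j` span an edge of `Q` (`cellWeight_pos_iff`).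

The weights are symmetric because the reflection that swaps `v i` and `v j` maps the cell of `j`
seen from `i` to the cell of `i` seen from `j` (`reflection_mem_inversionCell_iff`): a direction `x`
lies in the former exactly when a modified vector `tilt (v i) (v j) x` takes its maximum over `Q` at
`v i` and `v j`, and the reflection does not change that vector (`tilt_reflection`).

Finally, an isomorphism of face lattices induces an isomorphism of graphs, since vertices are the
minimal nonempty faces and edges are the faces with exactly two vertices
(`CombinatoriallyEquivalent.nonempty_graph_iso`).
-/

open scoped RealInnerProductSpace

open MeasureTheory EuclideanGeometry

/-! ### Graphs with a balanced edge weighting -/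

/-- A nonnegative symmetric weighting of the pairs of nodes of `G` whose support is exactly the set
of edges, and for which the weights of the edges at each node add up to the same `c > 0`. -/
structure IsBalancedWeighting {V : Type*} [Fintype V] (G : SimpleGraph V) (w : V → V → ℝ)
    (c : ℝ) : Prop where
  pos : 0 < c
  symm : ∀ i j, w i j = w j i
  nonneg : ∀ i j, 0 ≤ w i j
  pos_iff_adj : ∀ i j, 0 < w i j ↔ G.Adj i j
  sum_eq : ∀ i, ∑ j, w i j = c

namespace IsBalancedWeighting

variable {V : Type*} [Fintype V] {G : SimpleGraph V} {w : V → V → ℝ} {c : ℝ}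

theorem eq_zero_of_not_adj (h : IsBalancedWeighting G w c) {i j : V} (hij : ¬ G.Adj i j) :
    w i j = 0 :=
  le_antisymm (not_lt.1 fun h' => hij ((h.pos_iff_adj i j).1 h')) (h.nonneg i j)

/-- The weight inside the complement of an independent set `I` is
`c * (card Iᶜ - card I)`, because all the edges at `I` end in the complement. -/
theorem sum_compl_eq [DecidableEq V] (h : IsBalancedWeighting G w c) {I : Finset V}
    (hI : G.IsIndepSet (I : Set V)) :
    ∑ i ∈ Iᶜ, ∑ j ∈ Iᶜ, w i j = c * ((Fintype.card V : ℝ) - 2 * I.card) := by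
  have hrow : ∀ s : Finset V, ∑ i ∈ s, ∑ j, w i j = s.card * c := fun s => by
    rw [Finset.sum_congr rfl fun i _ => h.sum_eq i, Finset.sum_const, nsmul_eq_mul]
  have hsplit : ∀ s : Finset V, ∑ i ∈ s, ∑ j ∈ I, w i j + ∑ i ∈ s, ∑ j ∈ Iᶜ, w i j
      = s.card * c := fun s => by
    rw [← Finset.sum_add_distrib, ← hrow s]
    exact Finset.sum_congr rfl fun i _ => Finset.sum_add_sum_compl I _
  have h0 : ∑ i ∈ I, ∑ j ∈ I, w i j = 0 := by
    refine Finset.sum_eq_zero fun i hi => Finset.sum_eq_zero fun j hj => ?_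
    rcases eq_or_ne i j with rfl | hne
    · exact h.eq_zero_of_not_adj (G.irrefl)
    · exact h.eq_zero_of_not_adj (hI hi hj hne)
  have hsymm : ∑ i ∈ I, ∑ j ∈ Iᶜ, w i j = ∑ i ∈ Iᶜ, ∑ j ∈ I, w i j := by
    rw [Finset.sum_comm]
    exact Finset.sum_congr rfl fun i _ => Finset.sum_congr rfl fun j _ => h.symm _ _
  have h1 := hsplit I
  have h2 := hsplit Iᶜ
  have hc : (Iᶜ.card : ℝ) = Fintype.card V - I.card := by
    rw [Finset.card_compl, Nat.cast_sub (Finset.card_le_univ I)]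
  rw [hc] at h2
  linarith

theorem two_mul_card_le (h : IsBalancedWeighting G w c) {I : Finset V}
    (hI : G.IsIndepSet (I : Set V)) : 2 * I.card ≤ Fintype.card V := by
  classical
  have h1 : 0 ≤ c * ((Fintype.card V : ℝ) - 2 * I.card) := by
    rw [← h.sum_compl_eq hI]
    exact Finset.sum_nonneg fun i _ => Finset.sum_nonneg fun j _ => h.nonneg i j
  have h2 := nonneg_of_mul_nonneg_right h1 h.pos
  have h3 : ((2 * I.card : ℕ) : ℝ) ≤ (Fintype.card V : ℝ) := by push_cast; linarith
  exact_mod_cast h3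

theorem isBipartite (h : IsBalancedWeighting G w c) {I : Finset V}
    (hI : G.IsIndepSet (I : Set V)) (hcard : Fintype.card V = 2 * I.card) : G.IsBipartite := by
  classical
  have h1 : ∑ i ∈ Iᶜ, ∑ j ∈ Iᶜ, w i j = 0 := by
    rw [h.sum_compl_eq hI, hcard]; push_cast; ring
  have h2 : ∀ i ∉ I, ∀ j ∉ I, w i j = 0 := by
    intro i hi j hj
    have h3 := (Finset.sum_eq_zero_iff_of_nonneg
      fun i _ => Finset.sum_nonneg fun j _ => h.nonneg i j).1 h1 i (Finset.mem_compl.2 hi)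
    exact (Finset.sum_eq_zero_iff_of_nonneg fun j _ => h.nonneg i j).1 h3 j (Finset.mem_compl.2 hj)
  refine ⟨SimpleGraph.Coloring.mk (fun i => if i ∈ I then 0 else 1) fun {i j} hij => ?_⟩
  by_cases hi : i ∈ I <;> by_cases hj : j ∈ I
  · exact absurd hij (hI hi hj hij.ne)
  · simp [hi, hj]
  · simp [hi, hj]
  · exact absurd (h2 i hi j hj) ((h.pos_iff_adj i j).2 hij).ne'

/-- Balanced weightings are transported along graph isomorphisms. -/
theorem comap {W : Type*} [Fintype W] {H : SimpleGraph W} (h : IsBalancedWeighting G w c)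
    (e : H ≃g G) : IsBalancedWeighting H (fun i j => w (e i) (e j)) c where
  pos := h.pos
  symm _ _ := h.symm _ _
  nonneg _ _ := h.nonneg _ _
  pos_iff_adj i j := by rw [h.pos_iff_adj, e.map_adj_iff]
  sum_eq i := (Equiv.sum_comp e.toEquiv (fun j => w (e i) j)).trans (h.sum_eq _)

end IsBalancedWeighting

/-! ### Vertices, faces and edges of polytopes -/

namespace IsPolytope

variable {n : ℕ} {P F : Set (EuclideanSpace ℝ (Fin n))}

theorem convex (hP : IsPolytope P) : Convex ℝ P := by
  obtain ⟨S, -, -, rfl⟩ := hP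
  exact convex_convexHull ℝ S

theorem isCompact (hP : IsPolytope P) : IsCompact P := by
  obtain ⟨S, hS, -, rfl⟩ := hP
  exact hS.isCompact_convexHull ℝ

theorem finite_extremePoints (hP : IsPolytope P) : (P.extremePoints ℝ).Finite := by
  obtain ⟨S, hS, -, rfl⟩ := hP
  exact hS.subset extremePoints_convexHull_subset

theorem nonempty_extremePoints (hP : IsPolytope P) : (P.extremePoints ℝ).Nonempty := by
  refine hP.isCompact.extremePoints_nonempty ?_
  obtain ⟨S, -, hS, rfl⟩ := hP
  exact hS.convexHull

theorem exposed_eq_convexHull (hP : IsPolytope P) (hF : IsExposed ℝ P F) :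
    F = convexHull ℝ (F ∩ P.extremePoints ℝ) := by
  have hfin : (F ∩ P.extremePoints ℝ).Finite := hP.finite_extremePoints.inter_of_right _
  rw [← hF.isExtreme.extremePoints_eq] at hfin ⊢
  rw [← (hfin.isClosed_convexHull ℝ).closure_eq,
    closure_convexHull_extremePoints (hF.isCompact hP.isCompact) (hF.convex hP.convex)]

theorem eq_convexHull (hP : IsPolytope P) : P = convexHull ℝ (P.extremePoints ℝ) := by
  conv_lhs => rw [hP.exposed_eq_convexHull (IsExposed.refl P)]
  rw [Set.inter_eq_right.2 extremePoints_subset]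

theorem nonempty_exposed_inter (hP : IsPolytope P) (hF : IsExposed ℝ P F) (hne : F.Nonempty) :
    ∃ v : PolytopeVertex P, v.1 ∈ F := by
  rw [hP.exposed_eq_convexHull hF, convexHull_nonempty_iff] at hne
  obtain ⟨v, hvF, hv⟩ := hne
  exact ⟨⟨v, hv⟩, hvF⟩

theorem le_of_forall_vertex_le (hP : IsPolytope P) (l : StrongDual ℝ (EuclideanSpace ℝ (Fin n)))
    {r : ℝ} (h : ∀ u : PolytopeVertex P, l u.1 ≤ r) {y : EuclideanSpace ℝ (Fin n)} (hy : y ∈ P) :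
    l y ≤ r := by
  rw [hP.eq_convexHull] at hy
  exact convexHull_min (t := {x | l x ≤ r}) (fun u hu => h ⟨u, hu⟩)
    (convex_halfSpace_le l.toLinearMap.isLinear r) hy

/-- Every vertex of a polytope is a face: a hyperplane strictly separates it from the convex hull
of the other vertices. -/
theorem isExposed_singleton (hP : IsPolytope P) (v : PolytopeVertex P) :
    IsExposed ℝ P {v.1} := by
  have hfin : (P.extremePoints ℝ \ {v.1}).Finite := hP.finite_extremePoints.sdiff
  have hv : v.1 ∉ convexHull ℝ (P.extremePoints ℝ \ {v.1}) := fun hmem =>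
    ((hP.convex.mem_extremePoints_iff_mem_sdiff_convexHull_sdiff.1 v.2).2)
      (convexHull_mono (Set.sdiff_subset_sdiff_left extremePoints_subset) hmem)
  obtain ⟨l, r, hlr, hrv⟩ := geometric_hahn_banach_closed_point (convex_convexHull ℝ _)
    (hfin.isClosed_convexHull ℝ) hv
  have hlt : ∀ u : PolytopeVertex P, u ≠ v → l u.1 < l v.1 := fun u hu =>
    (hlr _ (subset_convexHull ℝ _ ⟨u.2, fun h => hu (Subtype.ext h)⟩)).trans hrv
  have hmax : ∀ y ∈ P, l y ≤ l v.1 := fun y hy => hP.le_of_forall_vertex_le l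
    (fun u => by
      rcases eq_or_ne u v with rfl | hu
      · exact le_rfl
      · exact (hlt u hu).le) hy
  have hF : IsExposed ℝ P (l.toExposed P) := ContinuousLinearMap.toExposed.isExposed
  have hE : l.toExposed P ∩ P.extremePoints ℝ = {v.1} := by
    ext u
    constructor
    · rintro ⟨⟨-, hu⟩, hu'⟩
      by_contra hne
      exact (hlt ⟨u, hu'⟩ fun h => hne (congrArg Subtype.val h)).not_ge (hu _ v.2.1)
    · rintro rfl
      exact ⟨⟨v.2.1, hmax⟩, v.2⟩
  rwa [hP.exposed_eq_convexHull hF, hE, convexHull_singleton] at hF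

/-- Edges are the faces containing exactly two vertices. -/
theorem adj_iff_exists_face (hP : IsPolytope P) {v w : PolytopeVertex P} :
    (polytopeGraph P).Adj v w ↔ v ≠ w ∧ ∃ F : FaceLattice P,
      ∀ u : PolytopeVertex P, u.1 ∈ F.1 ↔ u = v ∨ u = w := by
  refine and_congr_right fun _ => ⟨fun h => ⟨⟨_, h⟩, fun u => ⟨fun hu => ?_, ?_⟩⟩, ?_⟩
  · rcases (mem_extremePoints_iff_forall_segment.1 u.2).2 _ v.2.1 _ w.2.1 hu with h | h
    · exact Or.inl (Subtype.ext h.symm)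
    · exact Or.inr (Subtype.ext h.symm)
  · rintro (rfl | rfl)
    · exact left_mem_segment ℝ _ _
    · exact right_mem_segment ℝ _ _
  · rintro ⟨⟨F, hF⟩, h⟩
    have hE : F ∩ P.extremePoints ℝ = {v.1, w.1} := by
      ext u
      constructor
      · rintro ⟨hu, hu'⟩
        exact ((h ⟨u, hu'⟩).1 hu).imp (congrArg Subtype.val) (congrArg Subtype.val)
      · rintro (rfl | rfl)
        · exact ⟨(h v).2 (Or.inl rfl), v.2⟩
        · exact ⟨(h w).2 (Or.inr rfl), w.2⟩
    rwa [hP.exposed_eq_convexHull hF, hE, convexHull_pair] at hF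

/-- Two vertices are adjacent when some linear functional takes its maximum over the vertices at
these two and at no other one. -/
theorem adj_iff_exists_inner (hP : IsPolytope P) {v w : PolytopeVertex P} :
    (polytopeGraph P).Adj v w ↔ v ≠ w ∧ ∃ p : EuclideanSpace ℝ (Fin n), ⟪v.1, p⟫ = ⟪w.1, p⟫ ∧
      ∀ u : PolytopeVertex P, u ≠ v → u ≠ w → ⟪u.1, p⟫ < ⟪v.1, p⟫ := by
  rw [hP.adj_iff_exists_face]
  refine and_congr_right fun _ => ⟨?_, ?_⟩
  · rintro ⟨⟨F, hF⟩, h⟩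
    have hv := (h v).2 (Or.inl rfl)
    have hw := (h w).2 (Or.inr rfl)
    obtain ⟨l, rfl⟩ := hF ⟨_, hv⟩
    have hl : ∀ x, ⟪x, (InnerProductSpace.toDual ℝ _).symm l⟫ = l x := fun x => by
      rw [real_inner_comm, InnerProductSpace.toDual_symm_apply]
    refine ⟨(InnerProductSpace.toDual ℝ _).symm l, ?_, fun u huv huw => ?_⟩
    · simpa only [hl] using le_antisymm (hw.2 _ hv.1) (hv.2 _ hw.1)
    · simp only [hl]
      by_contra! hle
      exact ((h u).1 ⟨u.2.1, fun y hy => (hv.2 y hy).trans hle⟩).elim huv huw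
  · rintro ⟨p, hp, hlt⟩
    have hl : ∀ x, (innerSL ℝ p) x = ⟪x, p⟫ := fun x =>
      (innerSL_apply_apply ℝ p x).trans (real_inner_comm _ _)
    have hmax : ∀ y ∈ P, (innerSL ℝ p) y ≤ (innerSL ℝ p) v.1 := fun y hy =>
      hP.le_of_forall_vertex_le _ (fun u => by
        rw [hl, hl]
        by_cases hv : u = v
        · rw [hv]
        by_cases hw : u = w
        · rw [hw, hp]
        exact (hlt u hv hw).le) hy
    refine ⟨⟨(innerSL ℝ p).toExposed P, ContinuousLinearMap.toExposed.isExposed⟩,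
      fun u => ⟨fun hu => ?_, ?_⟩⟩
    · by_contra! hne
      have := hu.2 _ v.2.1
      rw [hl, hl] at this
      exact this.not_gt (hlt u hne.1 hne.2)
    · rintro (rfl | rfl)
      · exact ⟨u.2.1, hmax⟩
      · refine ⟨u.2.1, fun y hy => (hmax y hy).trans ?_⟩
        rw [hl, hl, hp]

/-- The vertex faces are the minimal nonempty faces. -/
theorem exists_eq_singleton_iff (hP : IsPolytope P) (F : FaceLattice P) :
    (∃ v : PolytopeVertex P, F.1 = {v.1}) ↔
      F.1 ≠ ∅ ∧ ∀ G : FaceLattice P, G ≤ F → G.1 ≠ ∅ → G = F := by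
  constructor
  · rintro ⟨v, hv⟩
    refine ⟨by simp [hv], fun G hG hne => Subtype.ext ?_⟩
    have hG' : G.1 ⊆ {v.1} := hv ▸ (hG : G.1 ⊆ F.1)
    rw [hv]
    exact (Set.subset_singleton_iff_eq.1 hG').resolve_left hne
  · rintro ⟨hne, hmin⟩
    obtain ⟨v, hv⟩ := hP.nonempty_exposed_inter F.2 (Set.nonempty_iff_ne_empty.2 hne)
    refine ⟨v, ?_⟩
    rw [← hmin ⟨{v.1}, hP.isExposed_singleton v⟩ (Set.singleton_subset_iff.2 hv)
      (Set.singleton_ne_empty _)]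

end IsPolytope

/-! ### Combinatorially equivalent polytopes have isomorphic graphs -/

section FaceLattice

variable {m n : ℕ} {P : Set (EuclideanSpace ℝ (Fin m))} {Q : Set (EuclideanSpace ℝ (Fin n))}

theorem FaceLattice.map_eq_empty_iff (e : FaceLattice P ≃o FaceLattice Q) (F : FaceLattice P) :
    (e F).1 = ∅ ↔ F.1 = ∅ := by
  have hP : ∀ F : FaceLattice P, F.1 = ∅ ↔ IsBot F := fun F =>
    ⟨fun h G => show F.1 ⊆ G.1 by simp [h],
      fun h => Set.subset_empty_iff.1 (h ⟨∅, isExposed_empty⟩)⟩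
  have hQ : ∀ F : FaceLattice Q, F.1 = ∅ ↔ IsBot F := fun F =>
    ⟨fun h G => show F.1 ⊆ G.1 by simp [h],
      fun h => Set.subset_empty_iff.1 (h ⟨∅, isExposed_empty⟩)⟩
  rw [hP, hQ]
  exact ⟨fun h G => e.le_iff_le.1 (h (e G)), fun h G => e.le_symm_apply.1 (h _)⟩

theorem FaceLattice.exists_vertex_map (hP : IsPolytope P) (hQ : IsPolytope Q)
    (e : FaceLattice P ≃o FaceLattice Q) (v : PolytopeVertex P) :
    ∃ v' : PolytopeVertex Q, (e ⟨{v.1}, hP.isExposed_singleton v⟩).1 = {v'.1} := by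
  obtain ⟨hne, hmin⟩ := (hP.exists_eq_singleton_iff ⟨{v.1}, hP.isExposed_singleton v⟩).1 ⟨v, rfl⟩
  refine (hQ.exists_eq_singleton_iff _).2 ⟨?_, fun G hG hGne => ?_⟩
  · rwa [Ne, FaceLattice.map_eq_empty_iff]
  · rw [← hmin (e.symm G) (e.symm_apply_le.2 hG) (by rwa [Ne, FaceLattice.map_eq_empty_iff]),
      e.apply_symm_apply]

/-- The vertex map induced by an isomorphism of face lattices preserves incidence of vertices and
faces. -/
theorem FaceLattice.exists_vertex_equiv (hP : IsPolytope P) (hQ : IsPolytope Q)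
    (e : FaceLattice P ≃o FaceLattice Q) :
    ∃ φ : PolytopeVertex P ≃ PolytopeVertex Q,
      ∀ (u : PolytopeVertex P) (F : FaceLattice P), (φ u).1 ∈ (e F).1 ↔ u.1 ∈ F.1 := by
  choose f hf using FaceLattice.exists_vertex_map hP hQ e
  choose g hg using FaceLattice.exists_vertex_map hQ hP e.symm
  have hf' : ∀ v, e ⟨{v.1}, hP.isExposed_singleton v⟩ = ⟨{(f v).1}, hQ.isExposed_singleton _⟩ :=
    fun v => Subtype.ext (hf v)
  have hg' : ∀ v, e.symm ⟨{v.1}, hQ.isExposed_singleton v⟩ =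
    ⟨{(g v).1}, hP.isExposed_singleton _⟩ := fun v => Subtype.ext (hg v)
  refine ⟨⟨f, g, fun v => ?_, fun v => ?_⟩, fun u F => ?_⟩
  · have h := hg (f v)
    rw [← hf', e.symm_apply_apply] at h
    exact Subtype.ext (Set.singleton_injective h).symm
  · have h := hf (g v)
    rw [← hg', e.apply_symm_apply] at h
    exact Subtype.ext (Set.singleton_injective h).symm
  · have h : e ⟨{u.1}, hP.isExposed_singleton u⟩ ≤ e F ↔ _ := e.le_iff_le
    rw [hf'] at h
    exact (Set.singleton_subset_iff.symm.trans h).trans Set.singleton_subset_iff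

theorem CombinatoriallyEquivalent.nonempty_graph_iso (hP : IsPolytope P) (hQ : IsPolytope Q)
    (h : CombinatoriallyEquivalent P Q) : Nonempty (polytopeGraph P ≃g polytopeGraph Q) := by
  obtain ⟨e⟩ := h
  obtain ⟨φ, hφ⟩ := FaceLattice.exists_vertex_equiv hP hQ e
  refine ⟨⟨φ, fun {v w} => ?_⟩⟩
  rw [hP.adj_iff_exists_face, hQ.adj_iff_exists_face, φ.injective.ne_iff]
  refine and_congr_right fun _ => ?_
  refine e.surjective.exists.trans (exists_congr fun F => φ.surjective.forall.trans ?_)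
  simp only [hφ, φ.injective.eq_iff]

end FaceLattice

/-! ### Cells of directions seen from a point of the sphere -/

section Cells

variable {E : Type*} [NormedAddCommGroup E] [InnerProductSpace ℝ E]

/-- For points `a`, `b` of the unit sphere, the vector `x` changed by a multiple of `a` so that it
has equal inner products with `a` and `b`. -/
noncomputable def tilt (a b x : E) : E :=
  x + (2 * (⟪inversion a 1 b, x⟫ - ⟪a, x⟫)) • a

theorem inner_inversion_one_sub (a b x : E) :
    ⟪inversion a 1 b, x⟫ - ⟪a, x⟫ = ⟪b - a, x⟫ / ‖b - a‖ ^ 2 := by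
  rw [inversion, vsub_eq_sub, vadd_eq_add, inner_add_left, real_inner_smul_left, dist_eq_norm,
    add_sub_cancel_right, div_pow, one_pow, one_div, inv_mul_eq_div]

/-- Comparing inverted points in direction `x` is the same as comparing the original points of the
sphere in direction `tilt a b x`. -/
theorem inner_inversion_sub_inner_inversion {a b c : E} (ha : ‖a‖ = 1) (hc : ‖c‖ = 1)
    (hca : c ≠ a) (x : E) : ⟪inversion a 1 c, x⟫ - ⟪inversion a 1 b, x⟫
      = (⟪c, tilt a b x⟫ - ⟪a, tilt a b x⟫) / ‖c - a‖ ^ 2 := by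
  have hD : ‖c - a‖ ^ 2 = 2 - 2 * ⟪c, a⟫ := by
    rw [norm_sub_sq_real, ha, hc]; ring
  have hD0 : 2 - 2 * ⟪c, a⟫ ≠ 0 := by
    rw [← hD]; exact pow_ne_zero 2 (norm_ne_zero_iff.2 (sub_ne_zero.2 hca))
  have h1 := inner_inversion_one_sub a c x
  have h2 : ⟪inversion a 1 c, x⟫ - ⟪inversion a 1 b, x⟫
      = (⟪inversion a 1 c, x⟫ - ⟪a, x⟫) - (⟪inversion a 1 b, x⟫ - ⟪a, x⟫) := by ring
  rw [h2, h1, tilt]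
  generalize ⟪inversion a 1 b, x⟫ - ⟪a, x⟫ = t
  rw [hD, inner_add_right, inner_add_right, real_inner_smul_right, real_inner_smul_right,
    real_inner_self_eq_norm_sq, ha, inner_sub_left]
  rw [eq_div_iff hD0, sub_mul, div_mul_cancel₀ _ hD0]
  ring

theorem inner_tilt_right {a b : E} (ha : ‖a‖ = 1) (hb : ‖b‖ = 1) (hba : b ≠ a) (x : E) :
    ⟪b, tilt a b x⟫ = ⟪a, tilt a b x⟫ := by
  have h := inner_inversion_sub_inner_inversion (b := b) ha hb hba x
  have h0 : ‖b - a‖ ^ 2 ≠ 0 := pow_ne_zero 2 (norm_ne_zero_iff.2 (sub_ne_zero.2 hba))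
  rw [sub_self, eq_comm, div_eq_zero_iff, or_iff_left h0] at h
  exact sub_eq_zero.1 h

/-- The reflection that swaps `a` and `b` intertwines the tilts seen from `a` and from `b`. -/
theorem tilt_reflection (a b x : E) :
    tilt b a ((ℝ ∙ (a - b))ᗮ.reflection x) = tilt a b x := by
  have hR : (ℝ ∙ (a - b))ᗮ.reflection x = x - (2 * (⟪a - b, x⟫ / ‖a - b‖ ^ 2)) • (a - b) := by
    rw [Submodule.reflection_orthogonal_apply, Submodule.reflection_singleton_apply, neg_sub,
      ← smul_assoc]
    simp
  have hn : ‖b - a‖ ^ 2 = ‖a - b‖ ^ 2 := by rw [norm_sub_rev]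
  have hinner : ⟪a - b, (ℝ ∙ (a - b))ᗮ.reflection x⟫ = - ⟪a - b, x⟫ := by
    rw [← (ℝ ∙ (a - b))ᗮ.reflection.inner_map_map (a - b) x,
      Submodule.reflection_orthogonalComplement_singleton_eq_neg, inner_neg_left, neg_neg]
  rw [tilt, tilt, inner_inversion_one_sub, inner_inversion_one_sub, hinner, hR, hn,
    ← neg_sub a b, inner_neg_left]
  module

/-- The cell of `j` seen from `i`, for points `v k` of the unit sphere: the directions in which,
after inversion in a sphere centred at `v i`, the point `v j` is farthest among the points other
than `v i`. The inverted points span the vertex figure at `v i`, and the cell is the normal cone of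
the vertex figure at the image of `v j`. -/
def inversionCell {ι : Type*} (v : ι → E) (i j : ι) : Set E :=
  {x | j ≠ i ∧ ∀ k, k ≠ i → ⟪inversion (v i) 1 (v k), x⟫ ≤ ⟪inversion (v i) 1 (v j), x⟫}

variable {ι : Type*} {v : ι → E}

theorem mem_inversionCell_iff (hv : Function.Injective v) (hn : ∀ i, ‖v i‖ = 1) {i j : ι} {x : E} :
    x ∈ inversionCell v i j ↔ j ≠ i ∧ ∀ k,
      ⟪v k, tilt (v i) (v j) x⟫ ≤ ⟪v i, tilt (v i) (v j) x⟫ := by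
  refine and_congr_right fun _ => forall_congr' fun k => ?_
  rcases eq_or_ne k i with rfl | hk
  · simp
  have hD : 0 < ‖v k - v i‖ ^ 2 := pow_pos (norm_pos_iff.2 (sub_ne_zero.2 (hv.ne hk))) 2
  rw [← sub_nonpos, inner_inversion_sub_inner_inversion (hn i) (hn k) (hv.ne hk),
    div_le_iff₀ hD, zero_mul, sub_nonpos]
  exact ⟨fun h => h hk, fun h _ => h⟩

/-- The reflection that swaps `v i` and `v j` takes the cell of `j` seen from `i` to the cell of
`i` seen from `j`. -/
theorem reflection_mem_inversionCell_iff (hv : Function.Injective v) (hn : ∀ i, ‖v i‖ = 1)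
    {i j : ι} {x : E} : (ℝ ∙ (v i - v j))ᗮ.reflection x ∈ inversionCell v j i ↔
      x ∈ inversionCell v i j := by
  rw [mem_inversionCell_iff hv hn, mem_inversionCell_iff hv hn, tilt_reflection, ne_comm]
  refine and_congr_right fun hji => ?_
  rw [inner_tilt_right (hn i) (hn j) (hv.ne hji)]

theorem isClosed_inversionCell (v : ι → E) (i j : ι) : IsClosed (inversionCell v i j) := by
  have : inversionCell v i j = {_x | j ≠ i} ∩ ⋂ k, ⋂ (_ : k ≠ i),
      {x | ⟪inversion (v i) 1 (v k), x⟫ ≤ ⟪inversion (v i) 1 (v j), x⟫} := by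
    ext x; simp [inversionCell]
  rw [this]
  exact isClosed_const.inter (isClosed_iInter fun k => isClosed_iInter fun _ =>
    isClosed_le (by fun_prop) (by fun_prop))

theorem exists_mem_inversionCell [Finite ι] {i j₀ : ι} (hj₀ : j₀ ≠ i) (v : ι → E) (x : E) :
    ∃ j, x ∈ inversionCell v i j := by
  obtain ⟨j, hj, hmax⟩ := Set.exists_max_image {k | k ≠ i}
    (fun k => ⟪inversion (v i) 1 (v k), x⟫) (Set.toFinite _) ⟨j₀, hj₀⟩
  exact ⟨j, hj, fun k hk => hmax k hk⟩

variable [MeasurableSpace E] [BorelSpace E] [FiniteDimensional ℝ E]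

theorem volume_inner_eq_inner {a b : E} (hab : a ≠ b) : volume {x : E | ⟪a, x⟫ = ⟪b, x⟫} = 0 := by
  have h : {x : E | ⟪a, x⟫ = ⟪b, x⟫} = ((ℝ ∙ (a - b))ᗮ : Submodule ℝ E) := by
    ext x
    simp [Submodule.mem_orthogonal_singleton_iff_inner_right, inner_sub_left, sub_eq_zero]
  rw [h]
  refine Measure.addHaar_submodule _ _ fun htop => ?_
  have : a - b ∈ (ℝ ∙ (a - b))ᗮ := htop ▸ Submodule.mem_top
  rw [Submodule.mem_orthogonal_singleton_iff_inner_right, inner_self_eq_zero, sub_eq_zero] at this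
  exact hab this

/-- The volume of the part of a cell in the unit ball, a multiple of the solid angle of the
cell. -/
noncomputable def cellWeight (v : ι → E) (i j : ι) : ℝ :=
  volume.real (inversionCell v i j ∩ Metric.ball 0 1)

theorem cellWeight_symm (hv : Function.Injective v) (hn : ∀ i, ‖v i‖ = 1) (i j : ι) :
    cellWeight v i j = cellWeight v j i := by
  have hpre : (ℝ ∙ (v i - v j))ᗮ.reflection ⁻¹' (inversionCell v j i ∩ Metric.ball 0 1)
      = inversionCell v i j ∩ Metric.ball 0 1 := by
    ext x
    simp [reflection_mem_inversionCell_iff hv hn]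
  rw [cellWeight, cellWeight, ← hpre, measureReal_def, measureReal_def]
  exact congrArg _ ((LinearIsometryEquiv.measurePreserving _).measure_preimage
    ((isClosed_inversionCell v j i).measurableSet.inter measurableSet_ball).nullMeasurableSet)

theorem sum_cellWeight [Fintype ι] (hv : Function.Injective v) {i j₀ : ι} (hj₀ : j₀ ≠ i) :
    ∑ j, cellWeight v i j = volume.real (Metric.ball (0 : E) 1) := by
  have hunion : ⋃ j, (inversionCell v i j ∩ Metric.ball 0 1) = Metric.ball (0 : E) 1 := by
    rw [← Set.iUnion_inter]
    refine Set.inter_eq_right.2 fun x _ => Set.mem_iUnion.2 (exists_mem_inversionCell hj₀ v x)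
  have hdisj : Pairwise (Function.onFun (AEDisjoint volume)
      fun j => inversionCell v i j ∩ Metric.ball (0 : E) 1) := by
    intro j k hjk
    refine measure_mono_null ?_ (volume_inner_eq_inner
      ((inversion_injective (v i) one_ne_zero).ne (hv.ne hjk)))
    rintro x ⟨⟨⟨hj, hxj⟩, -⟩, ⟨hk, hxk⟩, -⟩
    exact le_antisymm (hxk j hj) (hxj k hk)
  have h := measure_iUnion₀ (μ := volume) hdisj fun j =>
    ((isClosed_inversionCell v i j).measurableSet.inter measurableSet_ball).nullMeasurableSet
  rw [hunion, tsum_fintype] at h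
  rw [measureReal_def, h, ENNReal.toReal_sum fun j _ =>
    (measure_mono Set.inter_subset_right |>.trans_lt measure_ball_lt_top).ne]
  rfl

/-- A cell has positive volume exactly when a linear functional takes its maximum over the points
`v k` at `v i` and `v j` and at no other point. -/
theorem cellWeight_pos_iff [Finite ι] (hv : Function.Injective v) (hn : ∀ i, ‖v i‖ = 1)
    (i j : ι) : 0 < cellWeight v i j ↔ i ≠ j ∧ ∃ p : E, ⟪v i, p⟫ = ⟪v j, p⟫ ∧
      ∀ k, k ≠ i → k ≠ j → ⟪v k, p⟫ < ⟪v i, p⟫ := by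
  have hsub : ∀ {k}, k ≠ i → ∀ x, ⟪inversion (v i) 1 (v k), x⟫ < ⟪inversion (v i) 1 (v j), x⟫ ↔
      ⟪v k, tilt (v i) (v j) x⟫ < ⟪v i, tilt (v i) (v j) x⟫ := by
    intro k hk x
    have hD : 0 < ‖v k - v i‖ ^ 2 := pow_pos (norm_pos_iff.2 (sub_ne_zero.2 (hv.ne hk))) 2
    rw [← sub_neg, inner_inversion_sub_inner_inversion (hn i) (hn k) (hv.ne hk),
      div_lt_iff₀ hD, zero_mul, sub_neg]
  have hfin : volume (inversionCell v i j ∩ Metric.ball 0 1) ≠ ⊤ :=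
    (measure_mono Set.inter_subset_right |>.trans_lt measure_ball_lt_top).ne
  rw [cellWeight, measureReal_def, ENNReal.toReal_pos_iff, and_iff_left hfin.lt_top]
  constructor
  · intro hpos
    -- Off a null set of ties, the maximum that defines the cell is attained only at `j`.
    have hnull : volume (⋃ k, ⋃ (_ : k ≠ j),
        {x : E | ⟪inversion (v i) 1 (v k), x⟫ = ⟪inversion (v i) 1 (v j), x⟫}) = 0 :=
      measure_iUnion_null fun k => measure_iUnion_null fun hk =>
        volume_inner_eq_inner ((inversion_injective (v i) one_ne_zero).ne (hv.ne hk))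
    obtain ⟨x, ⟨hx, -⟩, hxt⟩ := Set.not_subset.1 fun h => hpos.ne' (measure_mono_null h hnull)
    refine ⟨hx.1.symm, tilt (v i) (v j) x,
      (inner_tilt_right (hn i) (hn j) (hv.ne hx.1) x).symm, fun k hki hkj => ?_⟩
    refine (hsub hki x).1 (lt_of_le_of_ne (hx.2 k hki) fun h => hxt ?_)
    exact Set.mem_iUnion₂.2 ⟨k, hkj, h⟩
  · rintro ⟨hij, p, hp, hlt⟩
    have htilt : tilt (v i) (v j) p = p := by
      rw [tilt, inner_inversion_one_sub, inner_sub_left, hp]; simp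
    -- The interior of the cell contains `p`, and since it is a cone it meets the unit ball.
    set U : Set E := ⋂ k, ⋂ (_ : k ≠ i ∧ k ≠ j),
      {x | ⟪inversion (v i) 1 (v k), x⟫ < ⟪inversion (v i) 1 (v j), x⟫} with hU
    have hopen : IsOpen U := isOpen_iInter_of_finite fun k => isOpen_iInter_of_finite fun _ =>
      isOpen_lt (by fun_prop) (by fun_prop)
    have hUcell : U ⊆ inversionCell v i j := by
      refine fun x hx => ⟨hij.symm, fun k hk => ?_⟩
      rcases eq_or_ne k j with rfl | hkj
      · exact le_rfl
      · exact (Set.mem_iInter₂.1 hx k ⟨hk, hkj⟩ : _ < _).le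
    have hs : (0 : ℝ) < (‖p‖ + 1)⁻¹ := by positivity
    have hmem : (‖p‖ + 1)⁻¹ • p ∈ U ∩ Metric.ball 0 1 := by
      refine ⟨Set.mem_iInter₂.2 fun k hk => ?_, ?_⟩
      · rw [Set.mem_ofPred_eq, real_inner_smul_right, real_inner_smul_right]
        refine mul_lt_mul_of_pos_left ((hsub hk.1 p).2 ?_) hs
        rw [htilt]
        exact hlt k hk.1 hk.2
      · rw [mem_ball_zero_iff, norm_smul, Real.norm_of_nonneg hs.le, inv_mul_lt_iff₀ (by positivity)]
        linarith
    exact ((hopen.inter Metric.isOpen_ball).measure_pos volume ⟨_, hmem⟩).trans_le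
      (measure_mono (Set.inter_subset_inter_left _ hUcell))

end Cells

/-! ### Inscribed polytopes -/

theorem IsDPolytope.nontrivial_vertex {d : ℕ} {Q : Set (EuclideanSpace ℝ (Fin d))}
    (hQ : IsDPolytope d Q) (hsph : Q.extremePoints ℝ ⊆ Metric.sphere 0 1) :
    Nontrivial (PolytopeVertex Q) := by
  obtain ⟨v, hv⟩ := hQ.1.nonempty_extremePoints
  by_contra hsub
  rw [not_nontrivial_iff_subsingleton] at hsub
  have hsing : Q.extremePoints ℝ = {v} := Set.eq_singleton_iff_unique_mem.2
    ⟨hv, fun u hu => congrArg Subtype.val (Subsingleton.elim (⟨u, hu⟩ : PolytopeVertex Q) ⟨v, hv⟩)⟩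
  have hd := hQ.2
  rw [hQ.1.eq_convexHull, hsing, convexHull_singleton, direction_affineSpan, vectorSpan_singleton,
    finrank_bot] at hd
  -- A polytope with a single vertex has dimension `0`, but the unit sphere of `ℝ⁰` is empty.
  subst hd
  have := hsph hv
  rw [Subsingleton.elim v 0] at this
  simp at this

/-- The solid angles of the cells form a balanced weighting of the graph of a polytope inscribed in
the unit sphere. -/
theorem IsDPolytope.isBalancedWeighting {d : ℕ} {Q : Set (EuclideanSpace ℝ (Fin d))}
    (hQ : IsDPolytope d Q) (hsph : Q.extremePoints ℝ ⊆ Metric.sphere 0 1)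
    [Fintype (PolytopeVertex Q)] :
    IsBalancedWeighting (polytopeGraph Q) (cellWeight (Subtype.val : PolytopeVertex Q → _))
      (volume.real (Metric.ball (0 : EuclideanSpace ℝ (Fin d)) 1)) := by
  have hn : ∀ i : PolytopeVertex Q, ‖i.1‖ = 1 := fun i => mem_sphere_zero_iff_norm.1 (hsph i.2)
  have := hQ.nontrivial_vertex hsph
  exact {
    pos := ENNReal.toReal_pos (Metric.measure_ball_pos volume _ one_pos).ne'
      measure_ball_lt_top.ne
    symm := cellWeight_symm Subtype.val_injective hn
    nonneg := fun _ _ => measureReal_nonneg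
    pos_iff_adj := fun i j => by
      rw [cellWeight_pos_iff Subtype.val_injective hn, hQ.1.adj_iff_exists_inner]
    sum_eq := fun i => sum_cellWeight Subtype.val_injective (exists_ne i).choose_spec }

theorem mainTheorem1 {n d : ℕ} (P : Set (EuclideanSpace ℝ (Fin n))) (hP : IsDPolytope d P)
    (I : Finset (PolytopeVertex P))
    (hI : (polytopeGraph P).IsIndepSet (I : Set (PolytopeVertex P)))
    (hcard : Nat.card (PolytopeVertex P) < 2 * I.card ∨
      (Nat.card (PolytopeVertex P) = 2 * I.card ∧ ¬ (polytopeGraph P).IsBipartite)) :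
    ¬ IsInscribable d P := by
  rintro ⟨Q, hQ, hPQ, hsph⟩
  have := hP.1.finite_extremePoints.fintype
  have := hQ.1.finite_extremePoints.fintype
  obtain ⟨e⟩ := hPQ.nonempty_graph_iso hP.1 hQ.1
  have hw := (hQ.isBalancedWeighting hsph).comap e
  rw [Nat.card_eq_fintype_card] at hcard
  rcases hcard with h | ⟨h, hbip⟩
  · exact (hw.two_mul_card_le hI).not_gt h
  · exact hbip (hw.isBipartite hI h)
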